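/- **Theorem 1.4.** For a prime $p$, an $\mathsf{AC}^0[p]$ circuit on $n$ input bits is a directed acyclic graph (parallel edges allowed) whose input nodes are labelled by the literals $x_i,\neg x_i$ and whose gates are NOT gates and AND, OR and $\mathrm{MOD}_p$ gates of unbounded fan-in, with one designated output; a $\mathrm{MOD}_p$ gate outputs $1$ if and only if the number of ones among its inputs is divisible by $p$. The size $|C|$ of a circuit $C$ is its number of gates (of all kinds), and its depth is the maximal number of AND, OR and $\mathrm{MOD}_p$ gates on a path from an input to the output. Let $\mathrm{Parity}_n\colon\{0,1\}^n\to\{0,1\}$ be the function with $\mathrm{Parity}_n(x)=1$ if and only if the number of ones in $x$ is odd. There is an absolute constant $c>0$ such that for every odd prime $p$ there is an $n_0=n_0(p)$ such that the following holds for all integers $d\ge 1$ and $n\ge n_0$. If $C$ is an $\mathsf{AC}^0[p]$ circuit on $n$ input bits of depth at most $d$ with $C^{-1}(1)\subseteq \mathrm{Parity}_n^{-1}(1)$, then $$\Pr_{x\sim\{0,1\}^n}\bigl[C(x)=\mathrm{Parity}_n(x)\bigr]\;\le\;\frac12+|C|\cdot 2^{-n^{c/d}},$$ where $x$ is uniformly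 distributed on $\{0,1\}^n$. -/

import Mathlib

/-- A wire of a circuit on `n` input bits in which `k` gates are available: it carries either an
input literal (`lit i true` is `xᵢ`, `lit i false` is `¬xᵢ`) or the output of an available gate. -/
inductive Wire (n k : ℕ) : Type
  | lit (i : Fin n) (b : Bool) : Wire n k
  | gate (j : Fin k) : Wire n k

/-- The bit carried by a wire on input `x`, if `v` gives the values of the gates. -/
def Wire.eval {n k : ℕ} (x : Fin n → Bool) (v : Fin k → Bool) : Wire n k → Bool
  | .lit i b => x i == b
  | .gate j => v j

/-- The depth at which a wire starts, if `h` gives the depths of the gates. -/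
def Wire.depth {n k : ℕ} (h : Fin k → ℕ) : Wire n k → ℕ
  | .lit _ _ => 0
  | .gate j => h j

/-- A gate over the basis NOT, AND, OR, MOD_`p`; the last three have unbounded fan-in
(any finite list of wires, possibly empty and possibly with repetitions). -/
inductive Gate (p n k : ℕ) : Type
  | notGate (w : Wire n k) : Gate p n k
  | andGate (ws : List (Wire n k)) : Gate p n k
  | orGate (ws : List (Wire n k)) : Gate p n k
  | modGate (ws : List (Wire n k)) : Gate p n k

/-- The output of a gate. A MOD_`p` gate outputs `1` exactly when the number of ones among its
incoming wires is divisible by `p`. -/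
def Gate.eval {p n k : ℕ} (x : Fin n → Bool) (v : Fin k → Bool) : Gate p n k → Bool
  | .notGate w => !(w.eval x v)
  | .andGate ws => ws.all (fun w => w.eval x v)
  | .orGate ws => ws.any (fun w => w.eval x v)
  | .modGate ws => decide (p ∣ ws.countP (fun w => w.eval x v))

/-- The depth of a gate: AND, OR and MOD_`p` gates add one level, NOT gates add none. -/
def Gate.depth {p n k : ℕ} (h : Fin k → ℕ) : Gate p n k → ℕ
  | .notGate w => w.depth h
  | .andGate ws => (ws.map (fun w => w.depth h)).foldr max 0 + 1
  | .orGate ws => (ws.map (fun w => w.depth h)).foldr max 0 + 1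
  | .modGate ws => (ws.map (fun w => w.depth h)).foldr max 0 + 1

/-- A circuit on `n` input bits over the basis NOT, AND, OR, MOD_`p`: a directed acyclic graph of
gates, listed in a topological order (the incoming wires of gate `j` are input literals or outputs
of gates with index `< j`; every gate may be used any number of times), with an output wire.
`size` is the number of gates, of all four kinds. -/
structure ModCircuit (p n : ℕ) where
  size : ℕ
  gate : (j : Fin size) → Gate p n j
  output : Wire n size

namespace ModCircuit

variable {p n : ℕ}

/-- The value of gate `j` on input `x`. -/
def gateEval (C : ModCircuit p n) (x : Fin n → Bool) (j : Fin C.size) : Bool :=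
  (C.gate j).eval x (fun i : Fin j => C.gateEval x ⟨i, i.2.trans j.2⟩)
termination_by j.val
decreasing_by exact i.2

/-- The Boolean function computed by the circuit. -/
def eval (C : ModCircuit p n) (x : Fin n → Bool) : Bool :=
  C.output.eval x (C.gateEval x)

/-- The maximal number of AND, OR and MOD_`p` gates on a path from an input to gate `j`
(inclusive). -/
def gateDepth (C : ModCircuit p n) (j : Fin C.size) : ℕ :=
  (C.gate j).depth (fun i : Fin j => C.gateDepth ⟨i, i.2.trans j.2⟩)
termination_by j.val
decreasing_by exact i.2

/-- The depth of the circuit: the maximal number of AND, OR and MOD_`p` gates on a path from an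
input to the output. -/
def depth (C : ModCircuit p n) : ℕ :=
  C.output.depth C.gateDepth

end ModCircuit

/-- `parity x = 1` if and only if the number of ones in `x` is odd. -/
def parity {n : ℕ} (x : Fin n → Bool) : Bool :=
  decide (Odd (Finset.univ.filter (fun i => x i = true)).card)

/-- The probability that `f x = g x` for a uniformly random `x ∈ {0,1}ⁿ`. -/
noncomputable def agreement {n : ℕ} (f g : (Fin n → Bool) → Bool) : ℝ :=
  ((Finset.univ.filter (fun x : Fin n → Bool => f x = g x)).card : ℝ) / 2 ^ n

/-!
By the Razborov–Smolensky method, a circuit of small size and depth agrees on almost all inputs with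
a Boolean function `g` of low degree `D` over `𝔽_p`: an OR of low-degree functions is computed by
a few of their sums, each chosen to be nonzero on at least half of the inputs on which the earlier
ones fail, and a MOD gate is computed exactly by Fermat's little theorem.

Such a `g` cannot be supported almost only on odd inputs unless its support `S` is small. There is a
space `W` of functions of degree at most `r` that are determined by their values on `S`, and `dim W`
is at least `|S|` times the density of the Hamming ball of radius `r`. If `2 * (D + r) < n`, then
functions of degree at most `D + r` are determined by their values on the even inputs, so, after
multiplication by `g`, the functions in `W` are determined by their values on the even points of
`S`. For `D` of order at most `√n` the density is bounded below, and a constant fraction of `S` is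
even, where the circuit, accepting only odd inputs, differs from `g`.

For large `n`, the degree `D` exceeds this order only if the depth exceeds `2 ^ (n ^ (c / d))`, and
then the bound is trivial, as the size is at least the depth.
-/

open Finset MvPolynomial

/-- Evaluation of polynomials at the points of the Boolean cube, with `true` read as `1`. -/
noncomputable def cubeEval (K ι : Type*) [CommSemiring K] :
    MvPolynomial ι K →ₐ[K] ((ι → Bool) → K) :=
  aeval fun i x => if x i then 1 else 0

/-- The functions on the Boolean cube given by polynomials of total degree at most `r`. -/
noncomputable def lowDegree (K : Type*) [CommSemiring K] {ι : Type*} (r : ℕ) :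
    Submodule K ((ι → Bool) → K) :=
  (restrictTotalDegree ι K r).map (cubeEval K ι).toLinearMap

section LowDegree

variable {K : Type*} [CommSemiring K] {ι : Type*} {r s : ℕ} {f g : (ι → Bool) → K}

lemma mem_lowDegree :
    f ∈ lowDegree K r ↔ ∃ P : MvPolynomial ι K, P.totalDegree ≤ r ∧ cubeEval K ι P = f := by
  simp only [lowDegree, Submodule.mem_map, mem_restrictTotalDegree, AlgHom.toLinearMap_apply]

lemma lowDegree_mono (h : r ≤ s) : lowDegree K r ≤ lowDegree (ι := ι) K s := by
  intro f hf
  obtain ⟨P, hP, rfl⟩ := mem_lowDegree.1 hf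
  exact mem_lowDegree.2 ⟨P, hP.trans h, rfl⟩

lemma one_mem_lowDegree (r : ℕ) : (1 : (ι → Bool) → K) ∈ lowDegree K r :=
  mem_lowDegree.2 ⟨1, by simp, map_one _⟩

lemma coord_mem_lowDegree (i : ι) :
    (fun x : ι → Bool => if x i then (1 : K) else 0) ∈ lowDegree K 1 :=
  mem_lowDegree.2 ⟨X i, (totalDegree_monomial_le _ _).trans (by simp), by simp [cubeEval]⟩

lemma mul_mem_lowDegree (hf : f ∈ lowDegree K r) (hg : g ∈ lowDegree K s) :
    f * g ∈ lowDegree K (r + s) := by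
  obtain ⟨P, hP, rfl⟩ := mem_lowDegree.1 hf
  obtain ⟨Q, hQ, rfl⟩ := mem_lowDegree.1 hg
  exact mem_lowDegree.2 ⟨P * Q, (totalDegree_mul P Q).trans (add_le_add hP hQ), map_mul _ _ _⟩

lemma pow_mem_lowDegree (hf : f ∈ lowDegree K r) (k : ℕ) : f ^ k ∈ lowDegree K (r * k) := by
  obtain ⟨P, hP, rfl⟩ := mem_lowDegree.1 hf
  refine mem_lowDegree.2 ⟨P ^ k, (totalDegree_pow P k).trans ?_, map_pow _ _ _⟩
  rw [mul_comm r]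
  gcongr

lemma comp_mem_lowDegree {κ : Type*} (e : ι → κ) (hf : f ∈ lowDegree K r) :
    (fun x : κ → Bool => f (x ∘ e)) ∈ lowDegree K r := by
  obtain ⟨P, hP, rfl⟩ := mem_lowDegree.1 hf
  refine mem_lowDegree.2 ⟨rename e P, (totalDegree_rename_le e P).trans hP, ?_⟩
  funext x
  rw [cubeEval, aeval_rename]
  simp [cubeEval, aeval_def, eval₂_eq, Function.comp_def]

end LowDegree

/-- The Walsh function `(-1) ^ ∑ i ∈ A, xᵢ`, a character of the Boolean cube. -/
def walsh (K : Type*) [CommRing K] {ι : Type*} (A : Finset ι) (x : ι → Bool) : K :=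
  ∏ i ∈ A, if x i then -1 else 1

section Walsh

variable {K : Type*} [CommRing K] {ι : Type*}

lemma walsh_update_not [DecidableEq ι] {A : Finset ι} {i : ι} (hi : i ∈ A) (x : ι → Bool) :
    walsh K A (Function.update x i (!x i)) = -walsh K A x := by
  have hrest : ∏ j ∈ A.erase i, (if Function.update x i (!x i) j then (-1 : K) else 1) =
      ∏ j ∈ A.erase i, if x j then -1 else 1 :=
    prod_congr rfl fun j hj => by rw [Function.update_of_ne (ne_of_mem_erase hj)]
  rw [walsh, walsh, ← mul_prod_erase A _ hi, ← mul_prod_erase A _ hi, hrest]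
  cases x i <;> simp

variable [Fintype ι]

lemma sum_walsh_mul_walsh (a x : ι → Bool) :
    ∑ A : Finset ι, walsh K A a * walsh K A x = if x = a then 2 ^ Fintype.card ι else 0 := by
  classical
  have hprod : ∑ A : Finset ι, walsh K A a * walsh K A x =
      ∏ i, (1 + (if a i then -1 else 1) * if x i then -1 else 1) := by
    simp only [walsh, ← prod_mul_distrib, prod_one_add, powerset_univ]
  rw [hprod]
  split_ifs with hx
  · subst hx
    refine prod_eq_pow_card fun i _ => ?_
    split_ifs <;> norm_num
  · obtain ⟨i, hi⟩ := Function.ne_iff.1 hx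
    refine prod_eq_zero (mem_univ i) ?_
    cases hxi : x i <;> cases hai : a i <;> simp_all

variable [DecidableEq ι]

lemma sum_walsh_mul_eq_zero_of_update {A : Finset ι} {i : ι} (hi : i ∈ A) {f : (ι → Bool) → K}
    (hf : ∀ x, f (Function.update x i (!x i)) = f x) : ∑ x, walsh K A x * f x = 0 := by
  refine sum_involution (fun x _ => Function.update x i (!x i)) ?_ ?_ ?_ ?_
  · intro x _
    rw [walsh_update_not hi, hf]
    ring
  · intro x _ _ hx
    simpa using congrFun hx i
  · simp
  · simp

lemma sum_walsh_mul_eq_zero_of_lowDegree {r : ℕ} {A : Finset ι} (hr : r < #A)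
    {f : (ι → Bool) → K} (hf : f ∈ lowDegree K r) : ∑ x, walsh K A x * f x = 0 := by
  obtain ⟨P, hP, rfl⟩ := mem_lowDegree.1 hf
  have heval (x : ι → Bool) : cubeEval K ι P x =
      ∑ m ∈ P.support, P.coeff m * ∏ i ∈ m.support, (if x i then 1 else 0) ^ m i := by
    simp [cubeEval, aeval_def, eval₂_eq]
  simp_rw [heval, mul_sum]
  rw [sum_comm]
  refine sum_eq_zero fun m hm => ?_
  have hcard : #m.support < #A := calc
    #m.support ≤ m.sum fun _ e => e := by
      rw [card_eq_sum_ones]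
      exact sum_le_sum fun i hi => Nat.one_le_iff_ne_zero.2 (Finsupp.mem_support_iff.1 hi)
    _ ≤ P.totalDegree := le_totalDegree hm
    _ ≤ r := hP
    _ < #A := hr
  obtain ⟨i, hiA, him⟩ := exists_mem_notMem_of_card_lt_card hcard
  refine sum_walsh_mul_eq_zero_of_update hiA fun x => ?_
  congr 1
  refine prod_congr rfl fun j hj => ?_
  rw [Function.update_of_ne (ne_of_mem_of_not_mem hj him)]

lemma eq_zero_of_sum_walsh_mul_eq_zero [IsDomain K] (h2 : (2 : K) ≠ 0)
    {f : (ι → Bool) → K} (hf : ∀ A, ∑ x, walsh K A x * f x = 0) : f = 0 := by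
  funext a
  have inversion : (2 : K) ^ Fintype.card ι * f a = 0 := calc
    (2 : K) ^ Fintype.card ι * f a
      = ∑ x, (∑ A, walsh K A a * walsh K A x) * f x := by simp [sum_walsh_mul_walsh]
    _ = ∑ A, walsh K A a * ∑ x, walsh K A x * f x := by
      simp_rw [sum_mul, mul_sum, mul_assoc]
      exact sum_comm
    _ = 0 := by simp [hf]
  exact (mul_eq_zero.1 inversion).resolve_left (pow_ne_zero _ h2)

lemma walsh_compl (A : Finset ι) (x : ι → Bool) :
    walsh K Aᶜ x = walsh K univ x * walsh K A x := by
  have hsq : walsh K A x * walsh K A x = 1 := by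
    rw [walsh, ← prod_mul_distrib]
    refine prod_eq_one fun i _ => ?_
    split_ifs <;> norm_num
  rw [show walsh K univ x = walsh K A x * walsh K Aᶜ x from (prod_mul_prod_compl A _).symm,
    mul_right_comm, hsq, one_mul]

end Walsh

section Parity

variable {K : Type*} [CommRing K] {n : ℕ}

lemma walsh_univ (x : Fin n → Bool) : walsh K univ x = if parity x then -1 else 1 := by
  simp only [walsh, parity, prod_ite, prod_const, one_pow, mul_one, decide_eq_true_eq]
  split_ifs with h
  · exact h.neg_one_pow
  · exact (Nat.not_odd_iff_even.1 h).neg_one_pow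

lemma two_mul_card_parity_eq_false (hn : 0 < n) :
    2 * #{x : Fin n → Bool | parity x = false} = 2 ^ n := by
  have hbalance : ∑ x : Fin n → Bool, walsh ℤ univ x = 0 := by
    simpa using sum_walsh_mul_eq_zero_of_lowDegree (A := (univ : Finset (Fin n)))
      (by simpa using hn) (one_mem_lowDegree (K := ℤ) 0)
  have htotal := card_filter_add_card_filter_not (s := (univ : Finset (Fin n → Bool)))
    (fun x => parity x = true)
  simp only [walsh_univ, sum_ite, sum_const, nsmul_eq_mul, mul_neg, mul_one,
    Bool.not_eq_true] at hbalance
  simp only [card_univ, Fintype.card_fun, Fintype.card_bool, Fintype.card_fin,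
    Bool.not_eq_true] at htotal
  omega

end Parity

section UniquenessSet

variable {α K : Type*} [Field K] {S : Finset α} {W : Submodule K (α → K)}

/-- `S` is a uniqueness set for the function space `W` if the functions in `W` are determined by
their values on `S`. -/
def IsUniquenessSet (S : Finset α) (W : Submodule K (α → K)) : Prop :=
  ∀ f ∈ W, (∀ x ∈ S, f x = 0) → f = 0

lemma IsUniquenessSet.finrank_le_card (h : IsUniquenessSet S W) : Module.finrank K W ≤ #S := by
  let restrict : W →ₗ[K] (S → K) := LinearMap.funLeft K K Subtype.val ∘ₗ W.subtype
  have hinj : Function.Injective restrict :=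
    (injective_iff_map_eq_zero restrict).2 fun f hf =>
      Subtype.ext (h f f.2 fun x hx => congrFun hf ⟨x, hx⟩)
  simpa using LinearMap.finrank_le_finrank_of_injective hinj

lemma exists_constants_isUniquenessSet (S : Finset α) :
    ∃ W ≤ Submodule.span K {(1 : α → K)}, IsUniquenessSet S W ∧
      (S.Nonempty → Module.finrank K W = 1) := by
  rcases S.eq_empty_or_nonempty with rfl | ⟨a, ha⟩
  · exact ⟨⊥, bot_le, fun f hf _ => (Submodule.mem_bot K).1 hf, by simp⟩
  · refine ⟨_, le_rfl, fun f hf hzero => ?_, fun _ => ?_⟩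
    · obtain ⟨c, rfl⟩ := Submodule.mem_span_singleton.1 hf
      have hc : c = 0 := by simpa using hzero a ha
      rw [hc, zero_smul]
    · exact finrank_span_singleton (Function.ne_iff.2 ⟨a, one_ne_zero⟩)

lemma isUniquenessSet_even (h2 : (2 : K) ≠ 0) {n r : ℕ} (hr : 2 * r < n) :
    IsUniquenessSet {x : Fin n → Bool | parity x = false} (lowDegree K r) := by
  intro f hf hzero
  -- Multiplying by the parity character negates `f`, so the Walsh coefficients of `f` at `A` and
  -- `Aᶜ` are opposite; one of these two sets has more than `r` elements.
  have hsign (x : Fin n → Bool) : walsh K univ x * f x = -f x := by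
    rw [walsh_univ]
    cases hx : parity x
    · simp [hzero x (by simpa using hx)]
    · simp
  have hcompl (A : Finset (Fin n)) :
      ∑ x, walsh K Aᶜ x * f x = -∑ x, walsh K A x * f x := by
    simp_rw [walsh_compl, mul_right_comm _ _ (f _), hsign, ← sum_neg_distrib]
    exact sum_congr rfl fun x _ => by ring
  refine eq_zero_of_sum_walsh_mul_eq_zero h2 fun A => ?_
  rcases lt_or_ge r #A with hA | hA
  · exact sum_walsh_mul_eq_zero_of_lowDegree hA hf
  · have hAc : r < #Aᶜ := by
      rw [card_compl, Fintype.card_fin]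
      omega
    rw [← neg_eq_zero, ← hcompl, sum_walsh_mul_eq_zero_of_lowDegree hAc hf]

end UniquenessSet

/-- The number of points in a Hamming ball of radius `r` in the Boolean cube of dimension `n`. -/
def ballCard (n r : ℕ) : ℕ := ∑ i ∈ range (r + 1), n.choose i

section BallCard

lemma ballCard_zero_right (n : ℕ) : ballCard n 0 = 1 := by simp [ballCard]

lemma ballCard_zero_left (r : ℕ) : ballCard 0 r = 1 := by simp [ballCard, sum_range_succ']

lemma ballCard_succ (n r : ℕ) :
    ballCard (n + 1) (r + 1) = ballCard n (r + 1) + ballCard n r := by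
  rw [ballCard, ballCard, sum_range_succ', sum_range_succ' _ (r + 1)]
  simp only [Nat.choose_succ_succ', sum_add_distrib, Nat.choose_zero_right, ballCard]
  ring

lemma ballCard_mono (n : ℕ) : Monotone (ballCard n) := fun _ _ h =>
  sum_le_sum_of_subset (range_mono (Nat.succ_le_succ h))

lemma centralBinom_sq_mul_le (m : ℕ) : m.centralBinom ^ 2 * (2 * m + 1) ≤ 16 ^ m := by
  induction m with
  | zero => simp
  | succ m ih =>
    refine le_of_mul_le_mul_left ?_ (by positivity : 0 < (m + 1) ^ 2)
    calc (m + 1) ^ 2 * ((m + 1).centralBinom ^ 2 * (2 * (m + 1) + 1))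
        = ((m + 1) * (m + 1).centralBinom) ^ 2 * (2 * m + 3) := by ring
      _ = (m.centralBinom ^ 2 * (2 * m + 1)) * (4 * ((2 * m + 1) * (2 * m + 3))) := by
        rw [Nat.succ_mul_centralBinom_succ]
        ring
      _ ≤ 16 ^ m * (4 * (4 * (m + 1) ^ 2)) := Nat.mul_le_mul ih (by nlinarith)
      _ = (m + 1) ^ 2 * 16 ^ (m + 1) := by ring

lemma choose_half_sq_mul_le (n : ℕ) : n.choose (n / 2) ^ 2 * (n + 1) ≤ 4 ^ n := by
  rcases Nat.even_or_odd' n with ⟨m, rfl | rfl⟩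
  · have h := centralBinom_sq_mul_le m
    rw [Nat.centralBinom_eq_two_mul_choose] at h
    rwa [Nat.mul_div_cancel_left m two_pos, pow_mul]
  · have hcentral : (m + 1).centralBinom = 2 * (2 * m + 1).choose m := by
      rw [Nat.centralBinom_eq_two_mul_choose, show 2 * (m + 1) = 2 * m + 1 + 1 by ring,
        Nat.choose_succ_succ', Nat.choose_symm_half]
      ring
    have h16 : 16 ^ (m + 1) = 4 * 4 ^ (2 * m + 1) := by
      rw [pow_succ 4 (2 * m), pow_mul]
      norm_num
      ring
    have h := centralBinom_sq_mul_le (m + 1)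
    rw [hcentral, h16] at h
    rw [show (2 * m + 1) / 2 = m by omega]
    nlinarith

lemma two_pow_le_two_mul_ballCard_add {n r s : ℕ} (hn : 2 * r + s + 1 = n) :
    2 ^ n ≤ 2 * ballCard n r + s * n.choose (n / 2) := by
  have hmiddle : ∑ i ∈ Ico (r + 1) (n - r), n.choose i ≤ s * n.choose (n / 2) := calc
    _ ≤ #(Ico (r + 1) (n - r)) • n.choose (n / 2) :=
      sum_le_card_nsmul _ _ _ fun i _ => Nat.choose_le_middle i n
    _ = s * n.choose (n / 2) := by
      rw [Nat.card_Ico, smul_eq_mul]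
      congr 1
      omega
  have htop : ∑ i ∈ Ico (n - r) (n + 1), n.choose i = ballCard n r := by
    have h := sum_Ico_reflect n.choose 0 (show r + 1 ≤ n + 1 by omega)
    rw [show n + 1 - (r + 1) = n - r by omega, Nat.sub_zero, ← range_eq_Ico] at h
    rw [← h, ballCard]
    exact sum_congr rfl fun i hi =>
      Nat.choose_symm (by have := mem_range.1 hi; omega)
  rw [← Nat.sum_range_choose n, ← sum_range_add_sum_Ico _ (by omega : n - r ≤ n + 1), htop,
    ← sum_range_add_sum_Ico _ (by omega : r + 1 ≤ n - r), ← ballCard]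
  omega

lemma exists_two_pow_le_four_mul_ballCard {n D : ℕ} (hD : 16 * (D + 1) ^ 2 ≤ n) :
    ∃ r, 2 * (D + r) < n ∧ 2 ^ n ≤ 4 * ballCard n r := by
  have hDn : 4 * D + 4 ≤ n := by nlinarith
  refine ⟨(n - 1) / 2 - D, by omega, ?_⟩
  obtain ⟨s, hs⟩ : ∃ s, 2 * ((n - 1) / 2 - D) + s + 1 = n :=
    ⟨n - 1 - 2 * ((n - 1) / 2 - D), by omega⟩
  have hball := two_pow_le_two_mul_ballCard_add hs
  have hmiddle : 2 * s * n.choose (n / 2) ≤ 2 ^ n := by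
    refine le_of_pow_le_pow_left₀ two_ne_zero (Nat.zero_le _) ?_
    calc (2 * s * n.choose (n / 2)) ^ 2
        ≤ ((4 * D + 4) * n.choose (n / 2)) ^ 2 := by gcongr; omega
      _ = n.choose (n / 2) ^ 2 * (16 * (D + 1) ^ 2) := by ring
      _ ≤ n.choose (n / 2) ^ 2 * (n + 1) := by gcongr; omega
      _ ≤ 4 ^ n := choose_half_sq_mul_le n
      _ = (2 ^ n) ^ 2 := by rw [← pow_mul, mul_comm, pow_mul]; norm_num
  linarith

end BallCard

section Slice

variable {n : ℕ}

/-- The slice of a subset of the Boolean cube on which the first coordinate equals `b`. -/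
def cubeSlice (b : Bool) (S : Finset (Fin (n + 1) → Bool)) : Finset (Fin n → Bool) :=
  {y | Fin.cons b y ∈ S}

lemma mem_cubeSlice {b : Bool} {S : Finset (Fin (n + 1) → Bool)} {y : Fin n → Bool} :
    y ∈ cubeSlice b S ↔ Fin.cons b y ∈ S := by
  simp [cubeSlice]

lemma card_cubeSlice_add_card_cubeSlice (S : Finset (Fin (n + 1) → Bool)) :
    #(cubeSlice false S) + #(cubeSlice true S) = #S := by
  have h (b : Bool) : #(cubeSlice b S) = #{x ∈ S | x 0 = b} := by
    refine card_nbij' (fun y => Fin.cons b y) Fin.tail (fun y hy => ?_) (fun x hx => ?_)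
      (fun y _ => rfl) (fun x hx => ?_)
    · simpa [mem_cubeSlice] using hy
    · obtain ⟨hxS, rfl⟩ : x ∈ S ∧ x 0 = b := by simpa using hx
      simpa [mem_cubeSlice, Fin.cons_self_tail] using hxS
    · obtain ⟨-, rfl⟩ : x ∈ S ∧ x 0 = b := by simpa using hx
      exact Fin.cons_self_tail x
  rw [h, h, add_comm]
  simpa using card_filter_add_card_filter_not (s := S) (fun x => x 0 = true)

/-- The linear map sending `(f, g)` to the function `f + x₀ g` in one more variable. -/
def addVar (K : Type*) [Field K] (n : ℕ) :
    ((Fin n → Bool) → K) × ((Fin n → Bool) → K) →ₗ[K] ((Fin (n + 1) → Bool) → K) :=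
  (LinearMap.funLeft K K Fin.tail).coprod
    (LinearMap.mulLeft K (fun x : Fin (n + 1) → Bool => if x 0 then (1 : K) else 0) ∘ₗ
      LinearMap.funLeft K K Fin.tail)

variable {K : Type*} [Field K]

lemma addVar_cons (f g : (Fin n → Bool) → K) (b : Bool) (y : Fin n → Bool) :
    addVar K n (f, g) (Fin.cons b y) = f y + if b then g y else 0 := by
  simp [addVar, LinearMap.funLeft_apply]

lemma addVar_injective : Function.Injective (addVar K n) := by
  refine (injective_iff_map_eq_zero _).2 ?_
  rintro ⟨f, g⟩ h
  have hcons (b : Bool) (y : Fin n → Bool) := congrFun h (Fin.cons b y)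
  simp only [addVar_cons, Pi.zero_apply] at hcons
  have hf : f = 0 := by funext y; simpa using hcons false y
  have hg : g = 0 := by funext y; simpa [hf] using hcons true y
  rw [hf, hg, Prod.mk_zero_zero]

lemma addVar_mem_lowDegree {r : ℕ} {f g : (Fin n → Bool) → K} (hf : f ∈ lowDegree K (r + 1))
    (hg : g ∈ lowDegree K r) : addVar K n (f, g) ∈ lowDegree K (r + 1) := by
  refine Submodule.add_mem _ (comp_mem_lowDegree Fin.succ hf) ?_
  rw [add_comm r]
  exact mul_mem_lowDegree (coord_mem_lowDegree 0) (comp_mem_lowDegree Fin.succ hg)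

/-- The space of functions `f + x₀ g` with `f ∈ W₁` and `g ∈ W₂`. -/
def addVarSpace (W₁ W₂ : Submodule K ((Fin n → Bool) → K)) :
    Submodule K ((Fin (n + 1) → Bool) → K) :=
  LinearMap.range (addVar K n ∘ₗ W₁.subtype.prodMap W₂.subtype)

variable {W₁ W₂ : Submodule K ((Fin n → Bool) → K)}

lemma mem_addVarSpace {h : (Fin (n + 1) → Bool) → K} :
    h ∈ addVarSpace W₁ W₂ ↔ ∃ f ∈ W₁, ∃ g ∈ W₂, addVar K n (f, g) = h := by
  simp [addVarSpace]

lemma finrank_addVarSpace (W₁ W₂ : Submodule K ((Fin n → Bool) → K)) :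
    Module.finrank K (addVarSpace W₁ W₂) = Module.finrank K W₁ + Module.finrank K W₂ := by
  rw [addVarSpace, LinearMap.finrank_range_of_inj, Module.finrank_prod]
  exact addVar_injective.comp (W₁.injective_subtype.prodMap W₂.injective_subtype)

lemma IsUniquenessSet.addVarSpace {S : Finset (Fin (n + 1) → Bool)}
    (h₁ : IsUniquenessSet (cubeSlice false S ∪ cubeSlice true S) W₁)
    (h₂ : IsUniquenessSet (cubeSlice false S ∩ cubeSlice true S) W₂) :
    IsUniquenessSet S (addVarSpace W₁ W₂) := by
  intro h hh hzero
  obtain ⟨f, hf, g, hg, rfl⟩ := mem_addVarSpace.1 hh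
  have hfalse (y) (hy : y ∈ cubeSlice false S) : f y = 0 := by
    simpa [addVar_cons] using hzero _ (mem_cubeSlice.1 hy)
  have htrue (y) (hy : y ∈ cubeSlice true S) : f y + g y = 0 := by
    simpa [addVar_cons] using hzero _ (mem_cubeSlice.1 hy)
  have hg0 : g = 0 := h₂ g hg fun y hy => by
    simpa [hfalse y (mem_inter.1 hy).1] using htrue y (mem_inter.1 hy).2
  have hf0 : f = 0 := h₁ f hf fun y hy =>
    (mem_union.1 hy).elim (hfalse y) fun hy => by simpa [hg0] using htrue y hy
  rw [hf0, hg0, Prod.mk_zero_zero, map_zero]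

variable (K) in
lemma exists_isUniquenessSet_lowDegree (r : ℕ) (S : Finset (Fin n → Bool)) :
    ∃ W ≤ lowDegree K r, IsUniquenessSet S W ∧
      #S * ballCard n r ≤ Module.finrank K W * 2 ^ n := by
  have constants {n r : ℕ} (S : Finset (Fin n → Bool)) (hball : ballCard n r = 1) :
      ∃ W ≤ lowDegree K r, IsUniquenessSet S W ∧
        #S * ballCard n r ≤ Module.finrank K W * 2 ^ n := by
    obtain ⟨W, hW, hSW, hdim⟩ := exists_constants_isUniquenessSet (K := K) S
    refine ⟨W, hW.trans ((Submodule.span_singleton_le_iff_mem _ _).2 (one_mem_lowDegree r)),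
      hSW, ?_⟩
    rcases S.eq_empty_or_nonempty with rfl | hS
    · simp
    · rw [hball, hdim hS, mul_one, one_mul]
      simpa using card_le_univ S
  induction n generalizing r with
  | zero => exact constants S (ballCard_zero_left r)
  | succ n ih =>
    cases r with
    | zero => exact constants S (ballCard_zero_right _)
    | succ r =>
      set S₀ := cubeSlice false S
      set S₁ := cubeSlice true S
      obtain ⟨W₁, hW₁, h₁, hdim₁⟩ := ih (r + 1) (S₀ ∪ S₁)
      obtain ⟨W₂, hW₂, h₂, hdim₂⟩ := ih r (S₀ ∩ S₁)
      refine ⟨addVarSpace W₁ W₂, fun h hh => ?_, h₁.addVarSpace h₂, ?_⟩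
      · obtain ⟨f, hf, g, hg, rfl⟩ := mem_addVarSpace.1 hh
        exact addVar_mem_lowDegree (hW₁ hf) (hW₂ hg)
      · have hrearrange : #(S₀ ∪ S₁) * ballCard n r + #(S₀ ∩ S₁) * ballCard n (r + 1) ≤
            #(S₀ ∪ S₁) * ballCard n (r + 1) + #(S₀ ∩ S₁) * ballCard n r :=
          mul_add_mul_le_mul_add_mul' (card_le_card inter_subset_union)
            (ballCard_mono n r.le_succ)
        rw [← card_cubeSlice_add_card_cubeSlice S, ← card_union_add_card_inter, ballCard_succ,
          pow_succ, finrank_addVarSpace]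
        linarith

lemma card_support_mul_ballCard_le (h2 : (2 : K) ≠ 0) [DecidableEq K] {D r : ℕ}
    (hr : 2 * (D + r) < n) {P : (Fin n → Bool) → K} (hP : P ∈ lowDegree K D) :
    #{x | P x ≠ 0} * ballCard n r ≤ #{x | parity x = false ∧ P x ≠ 0} * 2 ^ n := by
  obtain ⟨W, hW, hsupp, hdim⟩ := exists_isUniquenessSet_lowDegree K r {x | P x ≠ 0}
  -- Multiplication by `P` kills what happens off its support, at the cost of `D` in degree.
  have heven : IsUniquenessSet {x | parity x = false ∧ P x ≠ 0} W := by
    intro f hf hzero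
    have hPf : P * f = 0 := by
      refine isUniquenessSet_even h2 hr _ (mul_mem_lowDegree hP (hW hf)) fun x hx => ?_
      by_cases hPx : P x = 0
      · simp [hPx]
      · simp [hzero x (by simpa [hPx] using hx)]
    refine hsupp f hf fun x hx => ?_
    exact (mul_eq_zero.1 (congrFun hPf x)).resolve_left (mem_filter.1 hx).2
  exact hdim.trans (Nat.mul_le_mul_right _ heven.finrank_le_card)

end Slice

section Approximation

lemma exists_mem_two_mul_card_zeros_le {α M : Type*} [AddMonoid M] [DecidableEq M]
    (V : AddSubmonoid (α → M)) (X : Finset α) (hX : ∀ x ∈ X, ∃ h ∈ V, h x ≠ 0) :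
    ∃ l ∈ V, 2 * #{x ∈ X | l x = 0} ≤ #X := by
  induction X using Finset.strongInduction with
  | H X ih =>
    rcases X.eq_empty_or_nonempty with rfl | ⟨a, ha⟩
    · exact ⟨0, V.zero_mem, by simp⟩
    obtain ⟨h, hh, hha⟩ := hX a ha
    obtain ⟨l, hl, hhalf⟩ := ih {x ∈ X | h x = 0}
      (filter_ssubset.2 ⟨a, ha, hha⟩) fun x hx => hX x (mem_of_mem_filter x hx)
    have hsplit (f : α → M) : #{x ∈ X | f x = 0} =
        #{x ∈ {x ∈ X | h x = 0} | f x = 0} + #{x ∈ {x ∈ X | ¬h x = 0} | f x = 0} := by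
      rw [← card_filter_add_card_filter_not (s := {x ∈ X | f x = 0}) (fun x => h x = 0),
        filter_comm, filter_comm (fun x => f x = 0)]
    have hagree : {x ∈ {x ∈ X | h x = 0} | (l + h) x = 0} =
        {x ∈ {x ∈ X | h x = 0} | l x = 0} :=
      filter_congr fun x hx => by rw [Pi.add_apply, (mem_filter.1 hx).2, add_zero]
    have hdisjoint : #{x ∈ {x ∈ X | ¬h x = 0} | l x = 0} +
        #{x ∈ {x ∈ X | ¬h x = 0} | (l + h) x = 0} ≤ #{x ∈ X | ¬h x = 0} := by
      rw [← card_filter_add_card_filter_not (s := {x ∈ X | ¬h x = 0}) (fun x => l x = 0)]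
      refine Nat.add_le_add_left (card_le_card fun x hx => ?_) _
      obtain ⟨hxX, hsum⟩ := mem_filter.1 hx
      refine mem_filter.2 ⟨hxX, fun hlx => (mem_filter.1 hxX).2 ?_⟩
      rwa [Pi.add_apply, hlx, zero_add] at hsum
    have htotal := card_filter_add_card_filter_not (s := X) (fun x => h x = 0)
    have hl_split := hsplit l
    have hlh_split := hsplit (l + h)
    rw [hagree] at hlh_split
    -- Where `h` does not vanish, `l` and `l + h` have no common zero.
    by_cases hle : 2 * #{x ∈ {x ∈ X | ¬h x = 0} | l x = 0} ≤ #{x ∈ X | ¬h x = 0}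
    · exact ⟨l, hl, by omega⟩
    · exact ⟨l + h, V.add_mem hl hh, by omega⟩

lemma exists_ne_zero_of_mem_closure {α M : Type*} [AddMonoid M] {H : Set (α → M)} {l : α → M}
    (hl : l ∈ AddSubmonoid.closure H) {x : α} (hx : l x ≠ 0) : ∃ h ∈ H, h x ≠ 0 := by
  contrapose! hx
  induction hl using AddSubmonoid.closure_induction with
  | mem h hh => exact hx h hh
  | zero => rfl
  | add f g _ _ hf hg => rw [Pi.add_apply, hf, hg, add_zero]

lemma exists_mem_closure_two_mul_hammingDist_le {α M : Type*} [Fintype α] [AddMonoid M]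
    [DecidableEq M] {H : Set (α → M)} {u g : α → Bool} (hu : ∀ x, u x ↔ ∃ h ∈ H, h x ≠ 0)
    (hgu : ∀ x, g x → u x) :
    ∃ l ∈ AddSubmonoid.closure H,
      2 * hammingDist u (fun x => g x || l x ≠ 0) ≤ hammingDist u g := by
  have htrue {x : α} (hx : u x ≠ g x) : u x := by
    by_contra hux
    cases hgx : g x
    · exact hx (by rw [hgx, Bool.eq_false_of_not_eq_true hux])
    · exact hux (hgu x hgx)
  obtain ⟨l, hl, hhalf⟩ := exists_mem_two_mul_card_zeros_le (AddSubmonoid.closure H)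
    {x | u x ≠ g x} fun x hx =>
      have ⟨h, hh, hhx⟩ := (hu x).1 (htrue (mem_filter.1 hx).2)
      ⟨h, AddSubmonoid.subset_closure hh, hhx⟩
  refine ⟨l, hl, le_trans (Nat.mul_le_mul_left 2 (card_le_card fun x hx => ?_)) hhalf⟩
  have hne : u x ≠ (g x || l x ≠ 0) := (mem_filter.1 hx).2
  by_cases hlx : l x = 0
  · simpa [hlx] using hne
  · simp [hlx, (hu x).2 (exists_ne_zero_of_mem_closure hl hlx)] at hne

/-- The indicator function of a Boolean function. -/
def boolIndicator (K : Type*) [Zero K] [One K] {α : Type*} (g : α → Bool) (x : α) : K :=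
  if g x then 1 else 0

lemma sum_boolIndicator_apply {K α β : Type*} [NonAssocSemiring K] (ws : List β)
    (F : β → α → Bool) (x : α) :
    (ws.map fun w => boolIndicator K (F w)).sum x = (ws.countP (F · x) : K) := by
  induction ws with
  | nil => simp
  | cons w ws ih =>
    rw [List.map_cons, List.sum_cons, Pi.add_apply, ih, List.countP_cons]
    cases hw : F w x <;> simp [boolIndicator, hw, add_comm]

/-- The indicator function of `g` is given by a polynomial over `K` of degree at most `r`. -/
def HasDegreeLE (K : Type*) [CommSemiring K] {ι : Type*} (g : (ι → Bool) → Bool) (r : ℕ) : Prop :=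
  boolIndicator K g ∈ lowDegree K r

namespace HasDegreeLE

variable {K : Type*} {ι : Type*} {g : (ι → Bool) → Bool} {r s : ℕ}

lemma mono [CommSemiring K] (hg : HasDegreeLE K g r) (h : r ≤ s) : HasDegreeLE K g s :=
  lowDegree_mono h hg

lemma const_false [CommSemiring K] (r : ℕ) : HasDegreeLE K (fun _ : ι → Bool => false) r :=
  Submodule.zero_mem (lowDegree K r)

lemma not [CommRing K] (hg : HasDegreeLE K g r) : HasDegreeLE K (fun x => !g x) r := by
  have h : boolIndicator K (fun x => !g x) = 1 - boolIndicator K g := by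
    funext x
    cases hx : g x <;> simp [boolIndicator, hx]
  rw [HasDegreeLE, h]
  exact Submodule.sub_mem _ (one_mem_lowDegree r) hg

variable [Field K] [Fintype K]

lemma or_ne_zero [DecidableEq K] (hg : HasDegreeLE K g r) {l : (ι → Bool) → K}
    (hl : l ∈ lowDegree K s) :
    HasDegreeLE K (fun x => g x || l x ≠ 0) (r + s * (Fintype.card K - 1)) := by
  have hq : Fintype.card K - 1 ≠ 0 := Nat.sub_ne_zero_of_lt Fintype.one_lt_card
  have h : boolIndicator K (fun x => g x || l x ≠ 0) =
      1 - (1 - boolIndicator K g) * (1 - l ^ (Fintype.card K - 1)) := by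
    funext x
    by_cases hlx : l x = 0
    · cases hgx : g x <;> simp [boolIndicator, hgx, hlx, hq]
    · simp [boolIndicator, hlx, FiniteField.pow_card_sub_one_eq_one _ hlx]
  rw [HasDegreeLE, h]
  exact Submodule.sub_mem _ (one_mem_lowDegree _) (mul_mem_lowDegree
    (Submodule.sub_mem _ (one_mem_lowDegree _) hg)
    (Submodule.sub_mem _ (one_mem_lowDegree _) (pow_mem_lowDegree hl _)))

lemma dvd_countP {p : ℕ} [CharP K p] {β : Type*} (ws : List β) {F : β → (ι → Bool) → Bool}
    (hF : ∀ w ∈ ws, HasDegreeLE K (F w) r) :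
    HasDegreeLE K (fun x => p ∣ ws.countP (F · x)) (r * (Fintype.card K - 1)) := by
  classical
  have hsum : (ws.map fun w => boolIndicator K (F w)).sum ∈ lowDegree K r :=
    list_sum_mem (List.forall_mem_map.2 hF)
  have h := ((HasDegreeLE.const_false 0).or_ne_zero hsum).not
  rw [zero_add] at h
  simpa [sum_boolIndicator_apply, CharP.cast_eq_zero_iff K p] using h

end HasDegreeLE

variable {K : Type*} [Field K] [Fintype K] {ι : Type*} [Fintype ι] [DecidableEq ι] {r : ℕ}

lemma exists_approx_of_iff_exists_ne_zero {H : Set ((ι → Bool) → K)}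
    (hH : ∀ h ∈ H, h ∈ lowDegree K r) {u : (ι → Bool) → Bool}
    (hu : ∀ x, u x ↔ ∃ h ∈ H, h x ≠ 0) (t : ℕ) :
    ∃ g, HasDegreeLE K g (r * (Fintype.card K - 1) * t) ∧ (∀ x, g x → u x) ∧
      hammingDist u g * 2 ^ t ≤ 2 ^ Fintype.card ι := by
  classical
  induction t with
  | zero =>
    refine ⟨fun _ => false, HasDegreeLE.const_false _, by simp, ?_⟩
    simpa using hammingDist_le_card_fintype (x := u) (y := fun _ => false)
  | succ t ih =>
    obtain ⟨g, hdeg, hgu, herr⟩ := ih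
    obtain ⟨l, hl, hhalf⟩ := exists_mem_closure_two_mul_hammingDist_le hu hgu
    have hl_lowDegree : l ∈ lowDegree K r :=
      (AddSubmonoid.closure_le (S := (lowDegree K r).toAddSubmonoid)).2 hH hl
    refine ⟨fun x => g x || l x ≠ 0, (hdeg.or_ne_zero hl_lowDegree).mono (Nat.mul_succ _ _).ge,
      fun x hx => ?_, ?_⟩
    · exact (Bool.or_eq_true_iff.1 hx).elim (hgu x) fun hlx =>
        (hu x).2 (exists_ne_zero_of_mem_closure hl (of_decide_eq_true hlx))
    · calc hammingDist u (fun x => g x || l x ≠ 0) * 2 ^ (t + 1)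
          = 2 * hammingDist u (fun x => g x || l x ≠ 0) * 2 ^ t := by ring
        _ ≤ hammingDist u g * 2 ^ t := Nat.mul_le_mul_right _ hhalf
        _ ≤ 2 ^ Fintype.card ι := herr

lemma exists_any_approx {β : Type*} (ws : List β) {F : β → (ι → Bool) → Bool}
    (hF : ∀ w ∈ ws, HasDegreeLE K (F w) r) (t : ℕ) :
    ∃ g, HasDegreeLE K g (r * (Fintype.card K - 1) * t) ∧
      hammingDist (fun x => ws.any (F · x)) g * 2 ^ t ≤ 2 ^ Fintype.card ι := by
  have hany (x : ι → Bool) : ws.any (F · x) ↔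
      ∃ h ∈ {h : (ι → Bool) → K | ∃ w ∈ ws, boolIndicator K (F w) = h}, h x ≠ 0 := by
    simp [boolIndicator]
  obtain ⟨g, hdeg, -, herr⟩ := exists_approx_of_iff_exists_ne_zero
    (by rintro _ ⟨w, hw, rfl⟩; exact hF w hw) hany t
  exact ⟨g, hdeg, herr⟩

lemma exists_all_approx {β : Type*} (ws : List β) {F : β → (ι → Bool) → Bool}
    (hF : ∀ w ∈ ws, HasDegreeLE K (F w) r) (t : ℕ) :
    ∃ g, HasDegreeLE K g (r * (Fintype.card K - 1) * t) ∧
      hammingDist (fun x => ws.all (F · x)) g * 2 ^ t ≤ 2 ^ Fintype.card ι := by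
  obtain ⟨g, hdeg, herr⟩ := exists_any_approx ws (fun w hw => (hF w hw).not) t
  refine ⟨fun x => !g x, hdeg.not, ?_⟩
  have hcompl : hammingDist (fun x => !ws.any (!F · x)) (fun x => !g x) =
      hammingDist (fun x => ws.any (!F · x)) g :=
    hammingDist_comp (fun _ => not) fun _ => Bool.not_injective
  simp_rw [List.all_eq_not_any_not]
  rwa [hcompl]

end Approximation

section CircuitDepth

variable {p n k : ℕ}

lemma Wire.depth_le {h : Fin k → ℕ} {m : ℕ} (hm : ∀ i, h i ≤ m) (w : Wire n k) :
    w.depth h ≤ m := by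
  cases w with
  | lit i b => exact Nat.zero_le m
  | gate j => exact hm j

lemma Wire.depth_le_foldr_max (h : Fin k → ℕ) {ws : List (Wire n k)} {w : Wire n k}
    (hw : w ∈ ws) : w.depth h ≤ (ws.map fun w => w.depth h).foldr max 0 :=
  List.le_max_of_le' _ (List.mem_map_of_mem hw) le_rfl

lemma Gate.depth_le_succ {h : Fin k → ℕ} {m : ℕ} (hm : ∀ i, h i ≤ m) (G : Gate p n k) :
    G.depth h ≤ m + 1 := by
  have hlist (ws : List (Wire n k)) : (ws.map fun w => w.depth h).foldr max 0 ≤ m :=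
    List.max_le_of_forall_le _ _ (List.forall_mem_map.2 fun w _ => w.depth_le hm)
  cases G with
  | notGate w => exact (w.depth_le hm).trans m.le_succ
  | andGate ws | orGate ws | modGate ws => exact Nat.succ_le_succ (hlist ws)

namespace ModCircuit

lemma gateDepth_le (C : ModCircuit p n) (j : Fin C.size) : C.gateDepth j ≤ j + 1 := by
  induction j using WellFoundedLT.induction with
  | ind j ih =>
    rw [gateDepth]
    exact Gate.depth_le_succ (fun i => (ih ⟨i, i.2.trans j.2⟩ i.2).trans i.2) _

lemma depth_le_size (C : ModCircuit p n) : C.depth ≤ C.size :=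
  C.output.depth_le fun j => (C.gateDepth_le j).trans j.2

end ModCircuit

end CircuitDepth

section CircuitApproximation

lemma exists_forall_fin_of_forall_prefix {N : ℕ} {β : Fin N → Type*}
    {R : ∀ j : Fin N, (∀ i : Fin j, β ⟨i, i.2.trans j.2⟩) → β j → Prop}
    (step : ∀ j v, ∃ b, R j v b) :
    ∃ q : ∀ j, β j, ∀ j, R j (fun i => q ⟨i, i.2.trans j.2⟩) (q j) := by
  choose F hF using step
  let q : ∀ j, β j := wellFounded_lt.fix fun j v => F j fun i => v ⟨i, i.2.trans j.2⟩ i.2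
  have hq (j : Fin N) : q j = F j fun i => q ⟨i, i.2.trans j.2⟩ := wellFounded_lt.fix_eq _ j
  exact ⟨q, fun j => by rw [hq j]; exact hF j _⟩

variable {K : Type*} [Field K] {p n k : ℕ}

lemma Wire.hasDegreeLE_eval {b : ℕ} {h : Fin k → ℕ} {v : Fin k → (Fin n → Bool) → Bool}
    (hv : ∀ i, HasDegreeLE K (v i) (b ^ h i)) (w : Wire n k) :
    HasDegreeLE K (fun x => w.eval x (v · x)) (b ^ w.depth h) := by
  cases w with
  | gate j => exact hv j
  | lit i c =>
    have hcoord : HasDegreeLE K (fun x : Fin n → Bool => x i) 1 := coord_mem_lowDegree i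
    cases c with
    | true => simpa [Wire.eval, Wire.depth] using hcoord
    | false => simpa [Wire.eval, Wire.depth] using hcoord.not

variable [Fintype K] [CharP K p] {t : ℕ}

lemma Gate.exists_approx (ht : 1 ≤ t) {h : Fin k → ℕ} {v : Fin k → (Fin n → Bool) → Bool}
    (hv : ∀ i, HasDegreeLE K (v i) (((Fintype.card K - 1) * t) ^ h i)) (G : Gate p n k) :
    ∃ g, HasDegreeLE K g (((Fintype.card K - 1) * t) ^ G.depth h) ∧
      hammingDist (fun x => G.eval x (v · x)) g * 2 ^ t ≤ 2 ^ n := by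
  have hb : 1 ≤ (Fintype.card K - 1) * t :=
    Nat.mul_pos (Nat.sub_pos_of_lt Fintype.one_lt_card) ht
  have hlist (ws : List (Wire n k)) : ∀ w ∈ ws, HasDegreeLE K (fun x => w.eval x (v · x))
      (((Fintype.card K - 1) * t) ^ (ws.map fun w => w.depth h).foldr max 0) :=
    fun w hw => (w.hasDegreeLE_eval hv).mono
      (Nat.pow_le_pow_right hb (Wire.depth_le_foldr_max h hw))
  cases G with
  | notGate w => exact ⟨_, (w.hasDegreeLE_eval hv).not, by simp [Gate.eval]⟩
  | modGate ws =>
    refine ⟨_, (HasDegreeLE.dvd_countP ws (hlist ws)).mono ?_, by simp [Gate.eval]⟩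
    rw [Gate.depth, pow_succ, ← mul_assoc]
    exact Nat.le_mul_of_pos_right _ ht
  | orGate ws => simpa [Gate.depth, Gate.eval, pow_succ, mul_assoc] using
      exists_any_approx ws (hlist ws) t
  | andGate ws => simpa [Gate.depth, Gate.eval, pow_succ, mul_assoc] using
      exists_all_approx ws (hlist ws) t

namespace ModCircuit

lemma gateEval_eq_of_forall_eval_eq (C : ModCircuit p n) {x : Fin n → Bool}
    {v : Fin C.size → Bool}
    (hv : ∀ j : Fin C.size, (C.gate j).eval x (fun i => v ⟨i, i.2.trans j.2⟩) = v j) :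
    C.gateEval x = v := by
  funext j
  induction j using WellFoundedLT.induction with
  | ind j ih =>
    rw [gateEval, ← hv j]
    congr 1
    funext i
    exact ih ⟨i, i.2.trans j.2⟩ i.2

lemma hammingDist_eval_le (C : ModCircuit p n) (v : Fin C.size → (Fin n → Bool) → Bool) :
    hammingDist C.eval (fun x => C.output.eval x (v · x)) ≤
      ∑ j : Fin C.size,
        hammingDist (fun x => (C.gate j).eval x fun i => v ⟨i, i.2.trans j.2⟩ x) (v j) := by
  refine le_trans (card_le_card fun x hx => ?_) card_biUnion_le
  by_contra hgates
  simp only [mem_biUnion, mem_filter_univ, mem_univ, true_and, not_exists, not_not] at hgates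
  refine (mem_filter.1 hx).2 ?_
  rw [eval, C.gateEval_eq_of_forall_eval_eq (v := (v · x)) hgates]

theorem exists_approx (ht : 1 ≤ t) (C : ModCircuit p n) :
    ∃ g, HasDegreeLE K g (((Fintype.card K - 1) * t) ^ C.depth) ∧
      hammingDist C.eval g * 2 ^ t ≤ C.size * 2 ^ n := by
  obtain ⟨q, hq⟩ := exists_forall_fin_of_forall_prefix
    (β := fun j => {g // HasDegreeLE K g (((Fintype.card K - 1) * t) ^ C.gateDepth j)})
    (R := fun j v g =>
      hammingDist (fun x => (C.gate j).eval x fun i => (v i).1 x) g.1 * 2 ^ t ≤ 2 ^ n)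
    fun j v => by
      obtain ⟨g, hdeg, herr⟩ := (C.gate j).exists_approx ht fun i => (v i).2
      exact ⟨⟨g, by rwa [gateDepth]⟩, herr⟩
  refine ⟨_, C.output.hasDegreeLE_eval fun j => (q j).2, ?_⟩
  calc _ ≤ _ := Nat.mul_le_mul_right _ (C.hammingDist_eval_le fun j => (q j).1)
    _ ≤ ∑ _j : Fin C.size, 2 ^ n := by
        rw [sum_mul]
        exact sum_le_sum fun j _ => hq j
    _ = C.size * 2 ^ n := by simp

end ModCircuit

end CircuitApproximation

section Agreement

lemma HasDegreeLE.card_le_five_mul_hammingDist {K : Type*} [Field K] (h2 : (2 : K) ≠ 0) {n D : ℕ}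
    (hn : 16 * (D + 1) ^ 2 ≤ n) {f g : (Fin n → Bool) → Bool} (hg : HasDegreeLE K g D)
    (hf : ∀ x, f x → parity x) : #{x | f x} ≤ 5 * hammingDist f g := by
  classical
  obtain ⟨r, hr, hball⟩ := exists_two_pow_le_four_mul_ballCard hn
  have hsupport : #{x | g x} * ballCard n r ≤ #{x | parity x = false ∧ g x} * 2 ^ n := by
    simpa [boolIndicator] using card_support_mul_ballCard_le h2 hr hg
  have heven : #{x | parity x = false ∧ g x} ≤ hammingDist f g := by
    refine card_le_card fun x hx => mem_filter.2 ⟨mem_univ x, fun hfg => ?_⟩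
    obtain ⟨hparity, hgx⟩ := (mem_filter.1 hx).2
    exact Bool.false_ne_true (hparity.symm.trans (hf x (hfg.trans hgx)))
  have hg_le : #{x | g x} ≤ 4 * hammingDist f g := by
    refine le_of_mul_le_mul_right ?_ (Nat.two_pow_pos n)
    calc #{x | g x} * 2 ^ n ≤ #{x | g x} * (4 * ballCard n r) := Nat.mul_le_mul_left _ hball
      _ ≤ 4 * (#{x | parity x = false ∧ g x} * 2 ^ n) := by linarith
      _ ≤ 4 * hammingDist f g * 2 ^ n := by rw [← mul_assoc]; gcongr
  have hf_le : #{x | f x} ≤ #{x | g x} + hammingDist f g := by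
    refine le_trans (card_le_card fun x hx => ?_) (card_union_le _ _)
    by_cases hfg : f x = g x <;> simp_all
  omega

lemma agreement_le_one {n : ℕ} (f g : (Fin n → Bool) → Bool) : agreement f g ≤ 1 := by
  refine div_le_one_of_le₀ ?_ (by positivity)
  exact_mod_cast (card_le_univ _).trans_eq (by simp : Fintype.card (Fin n → Bool) = 2 ^ n)

lemma agreement_parity_eq {n : ℕ} (hn : 0 < n) {f : (Fin n → Bool) → Bool}
    (hf : ∀ x, f x → parity x) : agreement f parity = 1 / 2 + (#{x | f x} : ℝ) / 2 ^ n := by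
  have hagree : #{x | f x = parity x} = #{x : Fin n → Bool | parity x = false} + #{x | f x} := by
    rw [← card_union_of_disjoint (disjoint_filter.2 fun x _ hx hfx => by simp [hf x hfx] at hx),
      ← filter_or]
    congr 1 with x
    cases hfx : f x <;> cases hpx : parity x <;> simp_all
  have heven : 2 * (#{x : Fin n → Bool | parity x = false} : ℝ) = 2 ^ n := by
    exact_mod_cast two_mul_card_parity_eq_false hn
  rw [agreement, hagree]
  field_simp
  push_cast
  linarith

lemma rpow_one_div_eight_div_pow_pow (n : ℕ) {d : ℕ} (hd : 1 ≤ d) :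
    (((n : ℝ) ^ (1 / 8 / d : ℝ)) ^ d) ^ 8 = n := by
  rw [← pow_mul, ← Real.rpow_mul_natCast n.cast_nonneg]
  convert Real.rpow_one (n : ℝ) using 2
  push_cast
  field_simp

lemma exists_nat_add_three_le_le_five_mul {y : ℝ} (hy : 1 ≤ y) :
    ∃ t : ℕ, y + 3 ≤ t ∧ t ≤ 5 * y := by
  refine ⟨⌈y⌉₊ + 3, ?_, ?_⟩ <;> push_cast
  · linarith [Nat.le_ceil y]
  · linarith [Nat.ceil_lt_add_one (zero_le_one.trans hy)]

lemma five_div_two_pow_le_rpow_neg {y : ℝ} {t : ℕ} (hyt : y + 3 ≤ t) :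
    (5 : ℝ) / 2 ^ t ≤ 2 ^ (-y) := by
  rw [Real.rpow_neg two_pos.le, ← one_div, div_le_div_iff₀ (by positivity) (by positivity)]
  calc 5 * (2 : ℝ) ^ y ≤ 2 ^ y * 2 ^ (3 : ℝ) := by
        norm_num
        linarith [Real.rpow_pos_of_pos two_pos y]
    _ = 2 ^ (y + 3) := (Real.rpow_add two_pos y 3).symm
    _ ≤ 2 ^ (t : ℝ) := Real.rpow_le_rpow_of_exponent_le one_le_two hyt
    _ = 1 * 2 ^ t := by rw [Real.rpow_natCast, one_mul]

lemma sixteen_mul_add_one_sq_le {D n : ℕ} {z : ℝ} (hz : 3 ≤ z) (hD : D ≤ z ^ 2)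
    (hn : z ^ 8 ≤ n) : 16 * (D + 1) ^ 2 ≤ n := by
  have h9 : 9 ≤ z ^ 2 := by nlinarith
  have h : (16 * (D + 1) ^ 2 : ℝ) ≤ n := by
    calc (16 * (D + 1) ^ 2 : ℝ) ≤ 16 * (2 * z ^ 2) ^ 2 := by gcongr; linarith
      _ = 64 * (z ^ 2) ^ 2 := by ring
      _ ≤ (z ^ 2) ^ 2 * (z ^ 2) ^ 2 := by gcongr; nlinarith
      _ = z ^ 8 := by ring
      _ ≤ n := hn
  exact_mod_cast h

lemma two_rpow_le_of_pow_lt_pow {P m d : ℕ} {y : ℝ} (hP : (1 : ℝ) < P) (hmd : m ≤ d)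
    (hy : (P : ℝ) ^ 2 ^ P ≤ y ^ d) (hlt : y ^ d < P ^ m) : (2 : ℝ) ^ y ≤ m := by
  have hyP : y < P := lt_of_pow_lt_pow_left₀ d P.cast_nonneg
    (hlt.trans_le (pow_le_pow_right₀ hP.le hmd))
  have hm : 2 ^ P < m := (pow_lt_pow_iff_right₀ hP).1 (hy.trans_lt hlt)
  calc (2 : ℝ) ^ y ≤ 2 ^ (P : ℝ) := Real.rpow_le_rpow_of_exponent_le one_le_two hyP.le
    _ = (2 ^ P : ℕ) := by rw [Real.rpow_natCast]; push_cast; rfl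
    _ ≤ m := mod_cast hm.le

namespace ModCircuit

variable {p n : ℕ} {C : ModCircuit p n}

lemma agreement_parity_le (K : Type*) [Field K] [Fintype K] [CharP K p] (h2 : (2 : K) ≠ 0)
    {t : ℕ} (ht : 1 ≤ t) (hn : 16 * (((Fintype.card K - 1) * t) ^ C.depth + 1) ^ 2 ≤ n)
    (hC : ∀ x, C.eval x → parity x) :
    agreement C.eval parity ≤ 1 / 2 + C.size * (5 / 2 ^ t) := by
  obtain ⟨g, hdeg, herr⟩ := C.exists_approx (K := K) ht
  rw [agreement_parity_eq (hn.trans_lt' (by positivity)) hC]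
  gcongr
  rw [mul_div_assoc', div_le_div_iff₀ (by positivity) (by positivity)]
  norm_cast
  calc #{x | C.eval x} * 2 ^ t ≤ 5 * hammingDist C.eval g * 2 ^ t :=
        Nat.mul_le_mul_right _ (hdeg.card_le_five_mul_hammingDist h2 hn hC)
    _ ≤ C.size * 5 * 2 ^ n := by linarith

lemma agreement_parity_le_of_rpow_le_depth {y : ℝ} (hy : 2 ^ y ≤ (C.depth : ℝ)) :
    agreement C.eval parity ≤ 1 / 2 + C.size * 2 ^ (-y) := by
  have hsize : 1 ≤ C.size * (2 : ℝ) ^ (-y) := by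
    rw [Real.rpow_neg two_pos.le, ← div_eq_mul_inv, one_le_div (by positivity)]
    exact hy.trans (mod_cast C.depth_le_size)
  linarith [agreement_le_one C.eval parity]

lemma agreement_parity_le_of_pow_le (hp : p.Prime) (hodd : Odd p)
    (hC : ∀ x, C.eval x → parity x) {y z : ℝ} (hy : 1 ≤ y) (hz : 3 ≤ z)
    (hyz : y ^ C.depth ≤ z) (hpz : (5 * p : ℝ) ^ C.depth ≤ z) (hzn : z ^ 8 ≤ n) :
    agreement C.eval parity ≤ 1 / 2 + C.size * 2 ^ (-y) := by
  have : Fact p.Prime := ⟨hp⟩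
  have h2 : (2 : ZMod p) ≠ 0 := Ring.two_ne_zero (by
    rw [ZMod.ringChar_zmod_n]
    exact hodd.ne_two_of_dvd_nat dvd_rfl)
  obtain ⟨t, hyt, hty⟩ := exists_nat_add_three_le_le_five_mul hy
  have hdegree : 16 * (((p - 1) * t) ^ C.depth + 1) ^ 2 ≤ n := by
    refine sixteen_mul_add_one_sq_le hz ?_ hzn
    calc ((((p - 1) * t) ^ C.depth : ℕ) : ℝ) ≤ ((p * t) ^ C.depth : ℕ) := by
          gcongr
          exact p.sub_le 1
      _ = (p * t : ℝ) ^ C.depth := by push_cast; rfl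
      _ ≤ (p * (5 * y)) ^ C.depth := by gcongr
      _ = (5 * p) ^ C.depth * y ^ C.depth := by ring
      _ ≤ z * z := by gcongr
      _ = z ^ 2 := (sq z).symm
  have ht : 1 ≤ t := by exact_mod_cast (by linarith : (1 : ℝ) ≤ t)
  calc agreement C.eval parity ≤ 1 / 2 + C.size * (5 / 2 ^ t) :=
        agreement_parity_le (ZMod p) h2 ht (by rwa [ZMod.card]) hC
    _ ≤ 1 / 2 + C.size * 2 ^ (-y) := by
        gcongr
        exact five_div_two_pow_le_rpow_neg hyt

end ModCircuit

end Agreement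

theorem theorem1p4 :
    ∃ c : ℝ, 0 < c ∧ ∀ p : ℕ, p.Prime → Odd p → ∃ n₀ : ℕ, ∀ d : ℕ, 1 ≤ d →
      ∀ n : ℕ, n₀ ≤ n → ∀ C : ModCircuit p n, C.depth ≤ d →
        (∀ x : Fin n → Bool, C.eval x = true → parity x = true) →
        agreement C.eval parity ≤
          1 / 2 + (C.size : ℝ) * (2 : ℝ) ^ (-((n : ℝ) ^ (c / (d : ℝ)))) := by
  refine ⟨1 / 8, by norm_num, fun p hp hodd =>
    ⟨((5 * p) ^ 2 ^ (5 * p)) ^ 8, fun d hd n hn C hCd hC => ?_⟩⟩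
  set y : ℝ := (n : ℝ) ^ (1 / 8 / d : ℝ)
  have hP : (5 : ℝ) ≤ 5 * p := by linarith [(mod_cast hp.one_le : (1 : ℝ) ≤ p)]
  have hyn : (y ^ d) ^ 8 = n := rpow_one_div_eight_div_pow_pow n hd
  have hz : (5 * p : ℝ) ^ 2 ^ (5 * p) ≤ y ^ d := by
    refine le_of_pow_le_pow_left₀ (n := 8) (by norm_num) (by positivity) ?_
    rw [hyn]
    exact_mod_cast hn
  have hz3 : 3 ≤ y ^ d := by
    linarith [le_self_pow₀ (by linarith : 1 ≤ (5 * p : ℝ)) (Nat.two_pow_pos (5 * p)).ne']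
  have hy : 1 ≤ y := by
    by_contra! hlt
    linarith [pow_le_one₀ (n := d) (by positivity) hlt.le]
  rcases le_or_gt ((5 * p : ℝ) ^ C.depth) (y ^ d) with hle | hlt
  · exact ModCircuit.agreement_parity_le_of_pow_le hp hodd hC hy hz3
      (pow_le_pow_right₀ hy hCd) hle hyn.le
  · exact ModCircuit.agreement_parity_le_of_rpow_le_depth
      (two_rpow_le_of_pow_lt_pow (P := 5 * p) (by push_cast; linarith) hCd (mod_cast hz)
        (mod_cast hlt))
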